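/- Let $\tilde S,\tilde L\in\mathbb R^{n\times n}$ be skew-symmetric and $C=\tilde S+\tilde L$. Write $\|M\|_1=\sum_{i,j}|M_{ij}|$, $\|M\|_*$ for the nuclear norm, $\deg_{\max}(M)$ for the largest number of nonzero entries in a row or column of $M$, and $\mathrm{inc}(M)=\max_k\|UU^Te_k\|_2$, where $M=U\Sigma V^T$ is a compact singular value decomposition (so $UU^T$ is the orthogonal projection onto the column space of $M$). For $t\in[0,1]$ consider the convex program $$\min_{S,L}\; t\|S\|_1+(1-t)\|L\|_*\quad\text{subject to } S+L=C,\ S^T=-S,\ L^T=-L. \qquad (P_t)$$ For a choice of a solution $(\hat S_t,\hat L_t)$ of $(P_t)$ for every $t\in[0,1]$ and a step $\varepsilon>0$ put $\mathrm{diff}_t=\|\hat S_{t-\varepsilon}-\hat S_t\|_F+\|\hat L_{t-\varepsilon}-\hat L_t\|_F$ for $t\in[\varepsilon,1]$. Suppose $\deg_{\max}(\tilde S)\,\mathrm{inc}(\tilde L)<\tfrac1{12}$. Then $(P_t)$ has a solution for every $t\in[0,1]$, and there are numbers $0<a<t_1<t_2<b<1$ such that 1. for every $t\in[0,a]$ the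 unique solution of $(P_t)$ is $(C,0)$; 2. for every $t\in[t_1,t_2]$ the unique solution of $(P_t)$ is $(\tilde S,\tilde L)$; 3. for every $t\in[b,1]$ the unique solution of $(P_t)$ is $(0,C)$. Consequently $\mathrm{diff}_t$ vanishes on at least three regions: there is $\varepsilon_0>0$ with $\varepsilon_0<a$, $t_1+\varepsilon_0<t_2$ and $b+\varepsilon_0<1$ such that for every $0<\varepsilon\le\varepsilon_0$ and every choice of solutions, $\mathrm{diff}_t=0$ for all $t\in[\varepsilon,a]$, for all $t\in[t_1+\varepsilon,t_2]$ and for all $t\in[b+\varepsilon,1]$. If moreover $\tilde S\neq0$ and $\tilde L\neq0$, these regions are separated: $\mathrm{diff}_t\ne0$ for some $t\in(a,t_1+\varepsilon)$ and for some $t\in(t_2,b+\varepsilon)$. -/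

import Mathlib

open scoped Matrix

/-- The entrywise `ℓ₁` norm of a matrix: the sum of the absolute values of its entries. -/
def l1Norm {n : ℕ} (M : Matrix (Fin n) (Fin n) ℝ) : ℝ := ∑ i, ∑ j, |M i j|

/-- The nuclear norm of a matrix: the sum of its singular values. -/
noncomputable def nuclearNorm {n : ℕ} (M : Matrix (Fin n) (Fin n) ℝ) : ℝ :=
  ∑ i ∈ Finset.range n, (Matrix.toEuclideanLin M).singularValues i

/-- The Frobenius norm of a matrix. -/
noncomputable def frobNorm {n : ℕ} (M : Matrix (Fin n) (Fin n) ℝ) : ℝ :=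
  Real.sqrt (∑ i, ∑ j, (M i j) ^ 2)

/-- The largest number of nonzero entries in a row or a column of a matrix. -/
noncomputable def degMax {n : ℕ} (M : Matrix (Fin n) (Fin n) ℝ) : ℕ :=
  max (Finset.univ.sup fun i => Set.ncard {j | M i j ≠ 0})
    (Finset.univ.sup fun j => Set.ncard {i | M i j ≠ 0})

/-- `U * diag σ * Vᵀ` is a compact singular value decomposition of `M`. -/
structure IsCompactSVD {n r : ℕ} (M : Matrix (Fin n) (Fin n) ℝ)
    (U : Matrix (Fin n) (Fin r) ℝ) (σ : Fin r → ℝ) (V : Matrix (Fin n) (Fin r) ℝ) : Prop where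
  left_orthonormal : Uᵀ * U = 1
  right_orthonormal : Vᵀ * V = 1
  pos : ∀ i, 0 < σ i
  antitone : Antitone σ
  eq : M = U * Matrix.diagonal σ * Vᵀ

/-- The column space of a matrix, as a subspace of Euclidean space. -/
noncomputable def colSpace {n : ℕ} (M : Matrix (Fin n) (Fin n) ℝ) :
    Submodule ℝ (EuclideanSpace ℝ (Fin n)) :=
  LinearMap.range (Matrix.toEuclideanLin M)

/-- The maximum incoherence of the column space of a matrix: the largest Euclidean norm of the
orthogonal projection of a standard basis vector onto the column space. With a compact singular
value decomposition `M = U Σ Vᵀ` the projection is `U Uᵀ`; see `inc_eq_of_isCompactSVD`. -/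
noncomputable def inc {n : ℕ} (M : Matrix (Fin n) (Fin n) ℝ) : ℝ :=
  ⨆ k : Fin n, ‖(colSpace M).starProjection (EuclideanSpace.single k 1)‖

theorem inc_eq_of_isCompactSVD {n r : ℕ} {M : Matrix (Fin n) (Fin n) ℝ}
    {U : Matrix (Fin n) (Fin r) ℝ} {σ : Fin r → ℝ} {V : Matrix (Fin n) (Fin r) ℝ}
    (h : IsCompactSVD M U σ V) :
    inc M = ⨆ k : Fin n, ‖Matrix.toEuclideanLin (U * Uᵀ) (EuclideanSpace.single k 1)‖ := by
  have hM : (U * Uᵀ) * M = M := by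
    rw [h.eq]
    simp only [Matrix.mul_assoc]
    rw [← Matrix.mul_assoc Uᵀ U, h.left_orthonormal, Matrix.one_mul]
  have hσ : Matrix.diagonal σ * Matrix.diagonal (fun i => (σ i)⁻¹) = 1 := by
    rw [Matrix.diagonal_mul_diagonal, ← Matrix.diagonal_one]
    congr 1
    funext i
    exact mul_inv_cancel₀ (h.pos i).ne'
  have hU : U * Uᵀ = M * (V * (Matrix.diagonal (fun i => (σ i)⁻¹) * Uᵀ)) := by
    rw [h.eq]
    simp only [Matrix.mul_assoc]
    rw [← Matrix.mul_assoc Vᵀ V, h.right_orthonormal, Matrix.one_mul,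
      ← Matrix.mul_assoc (Matrix.diagonal σ), hσ, Matrix.one_mul]
  have hMt : Mᵀ * (1 - U * Uᵀ) = 0 := by
    have := congrArg Matrix.transpose hM
    rw [Matrix.transpose_mul, Matrix.transpose_mul, Matrix.transpose_transpose] at this
    rw [Matrix.mul_sub, Matrix.mul_one, this, sub_self]
  unfold inc
  congr 1
  funext k
  congr 1
  refine Submodule.eq_starProjection_of_mem_orthogonal ?_ ?_
  · refine ⟨WithLp.toLp 2 ((V * (Matrix.diagonal (fun i => (σ i)⁻¹) * Uᵀ)) *ᵥ
      (EuclideanSpace.single k (1 : ℝ)).ofLp), ?_⟩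
    simp only [Matrix.toLpLin_apply, Matrix.mulVec_mulVec, ← hU]
  · rw [Submodule.mem_orthogonal]
    rintro _ ⟨w, rfl⟩
    have hw : (Matrix.toEuclideanLin M w).ofLp = M *ᵥ w.ofLp := by simp [Matrix.toLpLin_apply]
    rw [EuclideanSpace.inner_eq_star_dotProduct, hw, star_trivial, WithLp.ofLp_sub,
      Matrix.toLpLin_apply]
    rw [dotProduct_comm, ← Matrix.vecMul_transpose, ← Matrix.dotProduct_mulVec]
    have : Mᵀ *ᵥ ((EuclideanSpace.single k (1 : ℝ)).ofLp -
        (U * Uᵀ) *ᵥ (EuclideanSpace.single k (1 : ℝ)).ofLp) = 0 := by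
      have h1 := congrArg (· *ᵥ (EuclideanSpace.single k (1 : ℝ)).ofLp) hMt
      simpa only [← Matrix.mulVec_mulVec, Matrix.sub_mulVec, Matrix.one_mulVec,
        Matrix.zero_mulVec] using h1
    rw [this, dotProduct_zero]

/-- The feasible decompositions `C = S + L` into two skew-symmetric matrices. -/
def feasible {n : ℕ} (C : Matrix (Fin n) (Fin n) ℝ) :
    Set (Matrix (Fin n) (Fin n) ℝ × Matrix (Fin n) (Fin n) ℝ) :=
  {p | p.1 + p.2 = C ∧ p.1ᵀ = -p.1 ∧ p.2ᵀ = -p.2}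

/-- The objective `t ‖S‖₁ + (1 - t) ‖L‖_*`. -/
noncomputable def objective {n : ℕ} (t : ℝ)
    (p : Matrix (Fin n) (Fin n) ℝ × Matrix (Fin n) (Fin n) ℝ) : ℝ :=
  t * l1Norm p.1 + (1 - t) * nuclearNorm p.2

/-- The set of all minimizers of `t ‖S‖₁ + (1 - t) ‖L‖_*` over the feasible decompositions. -/
def solutionSet {n : ℕ} (C : Matrix (Fin n) (Fin n) ℝ) (t : ℝ) :
    Set (Matrix (Fin n) (Fin n) ℝ × Matrix (Fin n) (Fin n) ℝ) :=
  {p | p ∈ feasible C ∧ IsMinOn (objective t) (feasible C) p}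

/-- `(S t, L t)`, `0 ≤ t ≤ 1`, is a choice of a minimizer for every parameter `t`. -/
def IsSolutionPath {n : ℕ} (C : Matrix (Fin n) (Fin n) ℝ)
    (S L : ℝ → Matrix (Fin n) (Fin n) ℝ) : Prop :=
  ∀ t ∈ Set.Icc (0 : ℝ) 1, (S t, L t) ∈ solutionSet C t

/-- The change of the solution path over a step of length `ε`:
`‖S (t - ε) - S t‖_F + ‖L (t - ε) - L t‖_F`. -/
noncomputable def diffT {n : ℕ} (S L : ℝ → Matrix (Fin n) (Fin n) ℝ) (ε t : ℝ) : ℝ :=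
  frobNorm (S (t - ε) - S t) + frobNorm (L (t - ε) - L t)

/-! ### Operator norm, entrywise bounds and the trace pairing -/

section NormBounds

open scoped Matrix.Norms.L2Operator

variable {n : ℕ}

/-! The two ends of the path come from comparing norms: `‖M‖_* ≤ ‖M‖₁ ≤ n ‖M‖_*`. When one weight
dominates, moving the other summand into the cheaper norm strictly lowers the objective
(`solutionSet_eq_left`, `solutionSet_eq_right`).

The middle interval is exact recovery with `γ = t / (1 - t)`. By duality, it suffices to find a `Q`
that is a subgradient of the nuclear norm at `L₀` and of `γ ‖·‖₁` at `S₀`, strictly so off the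
tangent space and off the support. Incoherence makes matrices in the tangent space of `L₀` spread
out, whereas `deg_max` bounds the operator norm of a matrix supported on `S₀` by its largest entry.
Composing the two projections is therefore a contraction, which makes the two spaces transversal and
lets `Q` be obtained by solving one linear equation (`exists_dualCertificate`). Strictness and
transversality give uniqueness (`l1Norm_add_nuclearNorm_lt`). The certificate exists for `3 inc < γ`
and `deg_max γ < 2/3`, an interval left open by the bound `1/12`.

Separation holds because steps of a small `ε` cannot jump over a plateau: if nothing changed between
two of them, their solutions would agree. -/

theorem norm_toEuclideanLin_le (A : Matrix (Fin n) (Fin n) ℝ) (x : EuclideanSpace ℝ (Fin n)) :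
    ‖Matrix.toEuclideanLin A x‖ ≤ ‖A‖ * ‖x‖ :=
  Matrix.l2_opNorm_mulVec A x

theorem l2OpNorm_le_of_forall {A : Matrix (Fin n) (Fin n) ℝ} {c : ℝ} (hc : 0 ≤ c)
    (h : ∀ x, ‖Matrix.toEuclideanLin A x‖ ≤ c * ‖x‖) : ‖A‖ ≤ c :=
  ContinuousLinearMap.opNorm_le_bound _ hc h

theorem l2OpNorm_transpose (A : Matrix (Fin n) (Fin n) ℝ) : ‖Aᵀ‖ = ‖A‖ := by
  rw [← Matrix.conjTranspose_eq_transpose_of_trivial, Matrix.l2_opNorm_conjTranspose]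

theorem toEuclideanLin_mul_apply (A B : Matrix (Fin n) (Fin n) ℝ)
    (x : EuclideanSpace ℝ (Fin n)) :
    Matrix.toEuclideanLin (A * B) x = Matrix.toEuclideanLin A (Matrix.toEuclideanLin B x) := by
  simp [Matrix.toLpLin_apply]

theorem inner_toEuclideanLin_left (A : Matrix (Fin n) (Fin n) ℝ)
    (x y : EuclideanSpace ℝ (Fin n)) :
    inner ℝ (Matrix.toEuclideanLin A x) y = inner ℝ x (Matrix.toEuclideanLin Aᵀ y) := by
  simp only [EuclideanSpace.inner_eq_star_dotProduct, Matrix.toLpLin_apply, star_trivial]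
  rw [dotProduct_comm, ← Matrix.vecMul_transpose, ← Matrix.dotProduct_mulVec, dotProduct_comm]

theorem transpose_mul_apply_eq_inner (A B : Matrix (Fin n) (Fin n) ℝ) (i j : Fin n) :
    (Aᵀ * B) i j = inner ℝ (Matrix.toEuclideanLin A (EuclideanSpace.single i 1))
      (Matrix.toEuclideanLin B (EuclideanSpace.single j 1)) := by
  simp [EuclideanSpace.inner_eq_star_dotProduct, Matrix.toLpLin_apply, dotProduct,
    Matrix.mul_apply, mul_comm]

theorem abs_transpose_mul_apply_le (A B : Matrix (Fin n) (Fin n) ℝ) (i j : Fin n) :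
    |(Aᵀ * B) i j| ≤ ‖Matrix.toEuclideanLin A (EuclideanSpace.single i 1)‖ *
      ‖Matrix.toEuclideanLin B (EuclideanSpace.single j 1)‖ := by
  rw [transpose_mul_apply_eq_inner]
  exact abs_real_inner_le_norm _ _

theorem norm_toEuclideanLin_single_le (A : Matrix (Fin n) (Fin n) ℝ) (i : Fin n) :
    ‖Matrix.toEuclideanLin A (EuclideanSpace.single i 1)‖ ≤ ‖A‖ := by
  simpa using norm_toEuclideanLin_le A (EuclideanSpace.single i 1)

theorem abs_apply_le_l2OpNorm (A : Matrix (Fin n) (Fin n) ℝ) (i j : Fin n) : |A i j| ≤ ‖A‖ := by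
  have h := abs_transpose_mul_apply_le 1 A i j
  have h1 : ‖Matrix.toEuclideanLin (1 : Matrix (Fin n) (Fin n) ℝ)
      (EuclideanSpace.single i 1)‖ = 1 := by simp
  rw [Matrix.transpose_one, Matrix.one_mul, h1, one_mul] at h
  exact h.trans (norm_toEuclideanLin_single_le A j)

theorem trace_transpose_mul_eq_sum (A B : Matrix (Fin n) (Fin n) ℝ) :
    (Aᵀ * B).trace = ∑ i, ∑ j, A i j * B i j := by
  rw [Finset.sum_comm]
  simp [Matrix.trace, Matrix.mul_apply]

theorem trace_transpose_mul_eq_sum_inner (A B : Matrix (Fin n) (Fin n) ℝ) {ι : Type*} [Fintype ι]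
    (b : OrthonormalBasis ι ℝ (EuclideanSpace ℝ (Fin n))) :
    (Aᵀ * B).trace =
      ∑ k, inner ℝ (Matrix.toEuclideanLin A (b k)) (Matrix.toEuclideanLin B (b k)) := by
  have h : (Aᵀ * B).trace = LinearMap.trace ℝ _ (Matrix.toEuclideanLin (Aᵀ * B)) := by
    rw [LinearMap.trace_eq_sum_inner _ (EuclideanSpace.basisFun (Fin n) ℝ)]
    simp only [Matrix.trace, Matrix.diag_apply, transpose_mul_apply_eq_inner,
      EuclideanSpace.basisFun_apply, toEuclideanLin_mul_apply, inner_toEuclideanLin_left]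
  rw [h, LinearMap.trace_eq_sum_inner _ b]
  simp only [toEuclideanLin_mul_apply, inner_toEuclideanLin_left]

/-- The Schur test. -/
theorem l2OpNorm_le_of_sum_abs_le {A : Matrix (Fin n) (Fin n) ℝ} {c : ℝ} (hc : 0 ≤ c)
    (hrow : ∀ i, ∑ j, |A i j| ≤ c) (hcol : ∀ j, ∑ i, |A i j| ≤ c) : ‖A‖ ≤ c := by
  refine l2OpNorm_le_of_forall hc fun x => ?_
  refine le_of_sq_le_sq ?_ (by positivity)
  rw [mul_pow, EuclideanSpace.real_norm_sq_eq, EuclideanSpace.real_norm_sq_eq]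
  have key : ∀ i, (Matrix.toEuclideanLin A x) i ^ 2 ≤ c * ∑ j, |A i j| * x j ^ 2 := by
    intro i
    have h1 : (Matrix.toEuclideanLin A x) i = ∑ j, A i j * x j := by
      simp [Matrix.toLpLin_apply, Matrix.mulVec, dotProduct]
    rw [h1]
    -- Cauchy–Schwarz with weights `|A i j|`.
    have h2 : (∑ j, A i j * x j) ^ 2 ≤ (∑ j, |A i j|) * ∑ j, |A i j| * x j ^ 2 := by
      refine Finset.sum_sq_le_sum_mul_sum_of_sq_le_mul _ (fun j _ => abs_nonneg _)
        (fun j _ => by positivity) fun j _ => ?_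
      rw [mul_pow, ← mul_assoc, ← sq, sq_abs]
    refine h2.trans (mul_le_mul_of_nonneg_right (hrow i) (Finset.sum_nonneg fun j _ => by positivity))
  calc ∑ i, (Matrix.toEuclideanLin A x) i ^ 2 ≤ ∑ i, c * ∑ j, |A i j| * x j ^ 2 :=
        Finset.sum_le_sum fun i _ => key i
    _ = c * ∑ j, (∑ i, |A i j|) * x j ^ 2 := by
        rw [← Finset.mul_sum, Finset.sum_comm]
        simp only [Finset.sum_mul]
    _ ≤ c * ∑ j, c * x j ^ 2 := by
        gcongr with j
        exact hcol j
    _ = c ^ 2 * ∑ j, x j ^ 2 := by rw [← Finset.mul_sum]; ring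

theorem sum_abs_le_of_support {s : Set (Fin n)} {f : Fin n → ℝ} {m : ℝ} {d : ℕ} (hm : 0 ≤ m)
    (hs : s.ncard ≤ d) (hf : ∀ j, j ∉ s → f j = 0) (hfm : ∀ j, |f j| ≤ m) :
    ∑ j, |f j| ≤ d * m := by
  classical
  have h1 : ∑ j, |f j| = ∑ j ∈ s.toFinset, |f j| := by
    refine (Finset.sum_subset (Finset.subset_univ _) fun j _ hj => ?_).symm
    rw [hf j (by simpa using hj), abs_zero]
  rw [h1]
  refine (Finset.sum_le_card_nsmul _ _ m fun j _ => hfm j).trans ?_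
  rw [nsmul_eq_mul, ← Set.ncard_eq_toFinset_card']
  gcongr

/-- This is where `degMax` enters: it counts the terms in each row and column sum of the Schur test.
-/
theorem l2OpNorm_le_degMax_mul {S X : Matrix (Fin n) (Fin n) ℝ} {m : ℝ} (hm : 0 ≤ m)
    (hX : ∀ i j, S i j = 0 → X i j = 0) (hXm : ∀ i j, |X i j| ≤ m) :
    ‖X‖ ≤ degMax S * m := by
  refine l2OpNorm_le_of_sum_abs_le (by positivity) (fun i => ?_) fun j => ?_
  · refine sum_abs_le_of_support (s := {j | S i j ≠ 0}) hm ?_ (fun j hj => hX i j ?_) (hXm i)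
    · exact le_max_of_le_left
        (Finset.le_sup (f := fun i => Set.ncard {j | S i j ≠ 0}) (Finset.mem_univ i))
    · simpa using hj
  · refine sum_abs_le_of_support (s := {i | S i j ≠ 0}) hm ?_ (fun i hi => hX i j ?_)
      fun i => hXm i j
    · exact le_max_of_le_right
        (Finset.le_sup (f := fun j => Set.ncard {i | S i j ≠ 0}) (Finset.mem_univ j))
    · simpa using hi

theorem l2OpNorm_le_card_mul {X : Matrix (Fin n) (Fin n) ℝ} {m : ℝ} (hm : 0 ≤ m)
    (hXm : ∀ i j, |X i j| ≤ m) : ‖X‖ ≤ n * m := by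
  refine l2OpNorm_le_of_sum_abs_le (by positivity) (fun i => ?_) fun j => ?_
  · simpa using Finset.sum_le_card_nsmul Finset.univ _ m fun j _ => hXm i j
  · simpa using Finset.sum_le_card_nsmul Finset.univ _ m fun i _ => hXm i j

end NormBounds

/-! ### Duality between operator and nuclear norm; comparison with `ℓ₁` -/

section NuclearNorm

open scoped Matrix.Norms.L2Operator

variable {n : ℕ}

/-- A basis of right singular vectors. -/
theorem exists_rightSingularBasis (M : Matrix (Fin n) (Fin n) ℝ) :
    ∃ b : OrthonormalBasis (Fin n) ℝ (EuclideanSpace ℝ (Fin n)), ∀ i j,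
      inner ℝ (Matrix.toEuclideanLin M (b i)) (Matrix.toEuclideanLin M (b j)) =
        if i = j then (Matrix.toEuclideanLin M).singularValues i ^ 2 else 0 := by
  set T := Matrix.toEuclideanLin M
  have hn : Module.finrank ℝ (EuclideanSpace ℝ (Fin n)) = n := by simp
  refine ⟨T.isSymmetric_adjoint_comp_self.eigenvectorBasis hn, fun i j => ?_⟩
  rw [← LinearMap.adjoint_inner_right, ← LinearMap.comp_apply,
    LinearMap.IsSymmetric.apply_eigenvectorBasis, ← T.sq_singularValues_fin hn, inner_smul_right,
    orthonormal_iff_ite.mp (OrthonormalBasis.orthonormal _)]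
  by_cases h : i = j
  · subst h; simp
  · simp [h]

/-- In a basis of right singular vectors, `M` sends the `k`-th vector to one of length `σ_k`, so
Cauchy–Schwarz applies term by term. -/
theorem trace_transpose_mul_le (Q M : Matrix (Fin n) (Fin n) ℝ) :
    (Qᵀ * M).trace ≤ ‖Q‖ * nuclearNorm M := by
  obtain ⟨b, hb⟩ := exists_rightSingularBasis M
  rw [trace_transpose_mul_eq_sum_inner Q M b, nuclearNorm, Finset.sum_range, Finset.mul_sum]
  refine Finset.sum_le_sum fun k _ => (real_inner_le_norm _ _).trans ?_
  have h1 : ‖Matrix.toEuclideanLin M (b k)‖ = (Matrix.toEuclideanLin M).singularValues k := by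
    have := hb k k
    rw [if_pos rfl, real_inner_self_eq_norm_sq] at this
    exact (sq_eq_sq₀ (norm_nonneg _) (LinearMap.singularValues_nonneg _ _)).mp this
  have h2 : ‖Matrix.toEuclideanLin Q (b k)‖ ≤ ‖Q‖ := by
    simpa using norm_toEuclideanLin_le Q (b k)
  rw [h1]
  exact mul_le_mul_of_nonneg_right h2 (LinearMap.singularValues_nonneg _ _)

theorem exists_trace_transpose_mul_eq_nuclearNorm (M : Matrix (Fin n) (Fin n) ℝ) :
    ∃ Q : Matrix (Fin n) (Fin n) ℝ, ‖Q‖ ≤ 1 ∧ (Qᵀ * M).trace = nuclearNorm M := by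
  obtain ⟨b, hb⟩ := exists_rightSingularBasis M
  set T := Matrix.toEuclideanLin M
  -- The partial isometry of the polar decomposition. Since `0⁻¹ = 0`, it kills the singular vectors
  -- with singular value zero.
  set w : Fin n → EuclideanSpace ℝ (Fin n) := fun k => (T.singularValues k)⁻¹ • T (b k)
  let R : EuclideanSpace ℝ (Fin n) →ₗ[ℝ] EuclideanSpace ℝ (Fin n) := b.toBasis.constr ℝ w
  have hRb : ∀ k, R (b k) = w k := fun k => by
    have := b.toBasis.constr_basis ℝ w k
    rwa [OrthonormalBasis.coe_toBasis] at this
  have hR : ∀ x, R x = ∑ k, b.repr x k • w k := fun x => by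
    conv_lhs => rw [← b.sum_repr x]
    simp only [map_sum, map_smul, hRb]
  have hw : ∀ i j, i ≠ j → inner ℝ (w i) (w j) = 0 := fun i j hij => by
    simp only [w, inner_smul_left, inner_smul_right, hb, if_neg hij, mul_zero]
  have hw1 : ∀ i, inner ℝ (w i) (w i) ≤ (1 : ℝ) := fun i => by
    simp only [w, inner_smul_left, inner_smul_right, hb, if_pos]
    by_cases h : T.singularValues i = 0
    · simp [h]
    · simp only [RCLike.conj_to_real]
      field_simp
      exact le_rfl
  refine ⟨Matrix.toEuclideanLin.symm R, l2OpNorm_le_of_forall zero_le_one fun x => ?_, ?_⟩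
  · rw [LinearEquiv.apply_symm_apply, one_mul]
    refine le_of_sq_le_sq ?_ (norm_nonneg _)
    rw [← real_inner_self_eq_norm_sq, hR, sum_inner]
    simp only [inner_sum]
    calc ∑ i, ∑ j, inner ℝ (b.repr x i • w i) (b.repr x j • w j)
        = ∑ i, b.repr x i ^ 2 * inner ℝ (w i) (w i) := by
          refine Finset.sum_congr rfl fun i _ => ?_
          rw [Finset.sum_eq_single i (fun j _ hj => by
            rw [inner_smul_left, inner_smul_right, hw i j hj.symm]; simp) (by simp)]
          rw [inner_smul_left, inner_smul_right, RCLike.conj_to_real]; ring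
      _ ≤ ∑ i, b.repr x i ^ 2 * 1 := by
          gcongr with i
          exact hw1 i
      _ = ‖x‖ ^ 2 := by
          rw [← b.repr.norm_map x, EuclideanSpace.real_norm_sq_eq]
          simp
  · rw [trace_transpose_mul_eq_sum_inner _ M b, nuclearNorm, Finset.sum_range]
    refine Finset.sum_congr rfl fun k _ => ?_
    rw [LinearEquiv.apply_symm_apply, hRb]
    simp only [w, inner_smul_left]
    change _ * inner ℝ (T (b k)) (T (b k)) = T.singularValues k
    rw [hb, if_pos rfl, RCLike.conj_to_real]
    by_cases h : T.singularValues k = 0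
    · simp [h]
    · field_simp

theorem nuclearNorm_le_of_forall {M : Matrix (Fin n) (Fin n) ℝ} {c : ℝ}
    (h : ∀ Q : Matrix (Fin n) (Fin n) ℝ, ‖Q‖ ≤ 1 → (Qᵀ * M).trace ≤ c) : nuclearNorm M ≤ c := by
  obtain ⟨Q, hQ, hQM⟩ := exists_trace_transpose_mul_eq_nuclearNorm M
  exact hQM ▸ h Q hQ

theorem nuclearNorm_nonneg (M : Matrix (Fin n) (Fin n) ℝ) : 0 ≤ nuclearNorm M :=
  Finset.sum_nonneg fun _ _ => LinearMap.singularValues_nonneg _ _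

theorem trace_transpose_mul_le_nuclearNorm {Q : Matrix (Fin n) (Fin n) ℝ} (hQ : ‖Q‖ ≤ 1)
    (M : Matrix (Fin n) (Fin n) ℝ) : (Qᵀ * M).trace ≤ nuclearNorm M :=
  (trace_transpose_mul_le Q M).trans (mul_le_of_le_one_left (nuclearNorm_nonneg M) hQ)

theorem nuclearNorm_add_le (A B : Matrix (Fin n) (Fin n) ℝ) :
    nuclearNorm (A + B) ≤ nuclearNorm A + nuclearNorm B :=
  nuclearNorm_le_of_forall fun Q hQ => by
    rw [Matrix.mul_add, Matrix.trace_add]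
    exact add_le_add (trace_transpose_mul_le_nuclearNorm hQ A)
      (trace_transpose_mul_le_nuclearNorm hQ B)

theorem nuclearNorm_zero : nuclearNorm (0 : Matrix (Fin n) (Fin n) ℝ) = 0 :=
  le_antisymm (nuclearNorm_le_of_forall fun Q _ => by simp) (nuclearNorm_nonneg _)

theorem nuclearNorm_le_l1Norm (M : Matrix (Fin n) (Fin n) ℝ) : nuclearNorm M ≤ l1Norm M :=
  nuclearNorm_le_of_forall fun Q hQ => by
    rw [trace_transpose_mul_eq_sum, l1Norm]
    gcongr with i _ j _
    calc Q i j * M i j ≤ |Q i j| * |M i j| := by rw [← abs_mul]; exact le_abs_self _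
      _ ≤ 1 * |M i j| := by
        gcongr
        exact (abs_apply_le_l2OpNorm Q i j).trans hQ
      _ = |M i j| := one_mul _

/-- Pairing with the sign matrix, whose operator norm is at most `n`. -/
theorem l1Norm_le_nuclearNorm (M : Matrix (Fin n) (Fin n) ℝ) :
    l1Norm M ≤ n * nuclearNorm M := by
  let X : Matrix (Fin n) (Fin n) ℝ := fun i j => SignType.sign (M i j)
  have hX : ‖X‖ ≤ n * 1 := l2OpNorm_le_card_mul zero_le_one fun i j => by
    rcases lt_trichotomy (M i j) 0 with h | h | h <;> simp [X, h]
  have h1 : (Xᵀ * M).trace = l1Norm M := by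
    rw [trace_transpose_mul_eq_sum, l1Norm]
    simp only [X, sign_mul_self]
  rw [← h1]
  refine (trace_transpose_mul_le X M).trans ?_
  rw [mul_one] at hX
  exact mul_le_mul_of_nonneg_right hX (nuclearNorm_nonneg M)

theorem l1Norm_zero : l1Norm (0 : Matrix (Fin n) (Fin n) ℝ) = 0 := by simp [l1Norm]

theorem l1Norm_neg (M : Matrix (Fin n) (Fin n) ℝ) : l1Norm (-M) = l1Norm M := by simp [l1Norm]

theorem abs_apply_le_l1Norm (M : Matrix (Fin n) (Fin n) ℝ) (i j : Fin n) :
    |M i j| ≤ l1Norm M :=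
  (Finset.single_le_sum (f := fun j => |M i j|) (fun _ _ => abs_nonneg _) (Finset.mem_univ j)).trans
    (Finset.single_le_sum (f := fun i => ∑ j, |M i j|)
      (fun _ _ => Finset.sum_nonneg fun _ _ => abs_nonneg _) (Finset.mem_univ i))

theorem eq_zero_of_l1Norm_le_zero {M : Matrix (Fin n) (Fin n) ℝ} (h : l1Norm M ≤ 0) : M = 0 := by
  ext i j
  exact abs_nonpos_iff.mp ((abs_apply_le_l1Norm M i j).trans h)

theorem l1Norm_add_le (A B : Matrix (Fin n) (Fin n) ℝ) :
    l1Norm (A + B) ≤ l1Norm A + l1Norm B := by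
  simp only [l1Norm, ← Finset.sum_add_distrib]
  gcongr with i _ j _
  exact abs_add_le _ _

theorem continuous_l1Norm : Continuous (l1Norm : Matrix (Fin n) (Fin n) ℝ → ℝ) := by
  unfold l1Norm
  fun_prop

/-- The triangle inequality makes the nuclear norm 1-Lipschitz for the `ℓ₁` norm. -/
theorem continuous_nuclearNorm : Continuous (nuclearNorm : Matrix (Fin n) (Fin n) ℝ → ℝ) := by
  have hle : ∀ A B : Matrix (Fin n) (Fin n) ℝ, nuclearNorm A ≤ nuclearNorm B + l1Norm (A - B) :=
    fun A B => by
      have := nuclearNorm_add_le B (A - B)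
      rw [add_sub_cancel] at this
      exact this.trans (add_le_add_right (nuclearNorm_le_l1Norm _) _)
  rw [continuous_iff_continuousAt]
  intro B
  have h0 : Filter.Tendsto (fun A => l1Norm (A - B)) (nhds B) (nhds 0) := by
    have : Continuous fun A : Matrix (Fin n) (Fin n) ℝ => l1Norm (A - B) :=
      continuous_l1Norm.comp (continuous_id.sub continuous_const)
    simpa [l1Norm_zero] using this.tendsto B
  refine tendsto_iff_dist_tendsto_zero.mpr (squeeze_zero (fun _ => dist_nonneg) (fun A => ?_) h0)
  rw [Real.dist_eq, abs_le]
  have h1 := hle A B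
  have h2 := hle B A
  rw [← neg_sub A B, l1Norm_neg] at h2
  constructor <;> linarith

end NuclearNorm

/-! ### Column space, tangent space and support projections -/

section Projection

open scoped Matrix.Norms.L2Operator

variable {n : ℕ}

theorem l2OpNorm_le_one_of_projection {P : Matrix (Fin n) (Fin n) ℝ} (hPt : Pᵀ = P)
    (hPP : P * P = P) : ‖P‖ ≤ 1 := by
  have h := Matrix.l2_opNorm_conjTranspose_mul_self P
  rw [Matrix.conjTranspose_eq_transpose_of_trivial, hPt, hPP] at h
  nlinarith [norm_nonneg P]

theorem transpose_one_sub_of_projection {P : Matrix (Fin n) (Fin n) ℝ} (hPt : Pᵀ = P) :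
    (1 - P)ᵀ = 1 - P := by
  rw [Matrix.transpose_sub, Matrix.transpose_one, hPt]

theorem one_sub_mul_one_sub_of_projection {P : Matrix (Fin n) (Fin n) ℝ} (hPP : P * P = P) :
    (1 - P) * (1 - P) = 1 - P := by
  rw [mul_sub, mul_one, sub_mul, hPP, one_mul, sub_self, sub_zero]

/-- Skew-symmetry makes row and column space coincide, so a single `P` acts as the identity on both
sides of `L`. -/
theorem exists_projection_colSpace {L : Matrix (Fin n) (Fin n) ℝ} (hL : Lᵀ = -L) :
    ∃ P : Matrix (Fin n) (Fin n) ℝ, Pᵀ = P ∧ P * P = P ∧ P * L = L ∧ L * P = L ∧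
      ∀ k, ‖Matrix.toEuclideanLin P (EuclideanSpace.single k 1)‖ ≤ inc L := by
  set P : Matrix (Fin n) (Fin n) ℝ :=
    Matrix.toEuclideanLin.symm (colSpace L).starProjection.toLinearMap
  have hP : ∀ x, Matrix.toEuclideanLin P x = (colSpace L).starProjection x := fun x => by
    simp only [P, LinearEquiv.apply_symm_apply]
    rfl
  have hext : ∀ {A B : Matrix (Fin n) (Fin n) ℝ},
      (∀ x, Matrix.toEuclideanLin A x = Matrix.toEuclideanLin B x) → A = B := fun h =>
    Matrix.toEuclideanLin.injective (LinearMap.ext h)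
  have hPt : Pᵀ = P := by
    refine hext fun x => ext_inner_left ℝ fun y => ?_
    rw [← inner_toEuclideanLin_left, hP, hP]
    exact Submodule.inner_starProjection_left_eq_right _ _ _
  have hPL : P * L = L := by
    refine hext fun x => ?_
    rw [toEuclideanLin_mul_apply, hP]
    exact Submodule.starProjection_eq_self_iff.mpr ⟨x, rfl⟩
  refine ⟨P, hPt, ?_, hPL, ?_, fun k => ?_⟩
  · refine hext fun x => ?_
    rw [toEuclideanLin_mul_apply, hP, hP]
    exact Submodule.starProjection_eq_self_iff.mpr (Submodule.starProjection_apply_mem _ _)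
  · have h := congrArg Matrix.transpose hPL
    rw [Matrix.transpose_mul, hPt, hL, Matrix.neg_mul, neg_inj] at h
    exact h
  · rw [hP]
    exact le_ciSup (f := fun k : Fin n =>
      ‖(colSpace L).starProjection (EuclideanSpace.single k 1)‖) (Set.finite_range _).bddAbove k

theorem inc_nonneg (L : Matrix (Fin n) (Fin n) ℝ) : 0 ≤ inc L :=
  Real.iSup_nonneg fun _ => norm_nonneg _

/-- Two blocks of norm at most one acting between orthogonal pairs of subspaces. -/
theorem l2OpNorm_block_le_one {P A B : Matrix (Fin n) (Fin n) ℝ} (hPt : Pᵀ = P) (hPP : P * P = P)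
    (hA : ‖A‖ ≤ 1) (hB : ‖B‖ ≤ 1) : ‖P * A * P + (1 - P) * B * (1 - P)‖ ≤ 1 := by
  have hPt' := transpose_one_sub_of_projection hPt
  have hPP' := one_sub_mul_one_sub_of_projection hPP
  have hortho : ∀ x y, inner ℝ (Matrix.toEuclideanLin P x)
      (Matrix.toEuclideanLin (1 - P) y) = 0 := fun x y => by
    have h0 : P * (1 - P) = 0 := by rw [mul_sub, hPP, mul_one, sub_self]
    rw [inner_toEuclideanLin_left, hPt, ← toEuclideanLin_mul_apply, h0]
    simp
  have hpyth : ∀ x y, ‖Matrix.toEuclideanLin P x + Matrix.toEuclideanLin (1 - P) y‖ ^ 2 =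
      ‖Matrix.toEuclideanLin P x‖ ^ 2 + ‖Matrix.toEuclideanLin (1 - P) y‖ ^ 2 := fun x y => by
    rw [norm_add_sq_real, hortho]
    ring
  have hblock : ∀ {R D : Matrix (Fin n) (Fin n) ℝ} (x), ‖R‖ ≤ 1 → ‖D‖ ≤ 1 →
      ‖Matrix.toEuclideanLin R (Matrix.toEuclideanLin D (Matrix.toEuclideanLin R x))‖ ≤
        ‖Matrix.toEuclideanLin R x‖ := fun {R D} x hR hD =>
    ((norm_toEuclideanLin_le R _).trans (mul_le_of_le_one_left (norm_nonneg _) hR)).trans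
      ((norm_toEuclideanLin_le D _).trans (mul_le_of_le_one_left (norm_nonneg _) hD))
  refine l2OpNorm_le_of_forall zero_le_one fun x => ?_
  rw [one_mul]
  refine le_of_sq_le_sq ?_ (norm_nonneg _)
  rw [map_add, LinearMap.add_apply, toEuclideanLin_mul_apply, toEuclideanLin_mul_apply,
    toEuclideanLin_mul_apply (_ * B), toEuclideanLin_mul_apply _ B, hpyth]
  have hx : ‖x‖ ^ 2 =
      ‖Matrix.toEuclideanLin P x‖ ^ 2 + ‖Matrix.toEuclideanLin (1 - P) x‖ ^ 2 := by
    rw [← hpyth, map_sub, LinearMap.sub_apply, add_sub_cancel]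
    simp
  rw [hx]
  gcongr
  · exact hblock x (l2OpNorm_le_one_of_projection hPt hPP) hA
  · exact hblock x (l2OpNorm_le_one_of_projection hPt' hPP') hB

/-- The projection onto the tangent space `{P * A + B * P}` of the matrices of a fixed rank. -/
def tangentProj (P : Matrix (Fin n) (Fin n) ℝ) :
    Matrix (Fin n) (Fin n) ℝ →ₗ[ℝ] Matrix (Fin n) (Fin n) ℝ :=
  LinearMap.mulLeft ℝ P + LinearMap.mulLeft ℝ (1 - P) ∘ₗ LinearMap.mulRight ℝ P

theorem tangentProj_apply (P M : Matrix (Fin n) (Fin n) ℝ) :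
    tangentProj P M = P * M + (1 - P) * (M * P) := rfl

theorem sub_tangentProj (P M : Matrix (Fin n) (Fin n) ℝ) :
    M - tangentProj P M = (1 - P) * M * (1 - P) := by
  rw [tangentProj_apply]
  noncomm_ring

/-- The projection onto the matrices supported on the support of `S`. -/
noncomputable def supportProj (S : Matrix (Fin n) (Fin n) ℝ) :
    Matrix (Fin n) (Fin n) ℝ →ₗ[ℝ] Matrix (Fin n) (Fin n) ℝ where
  toFun X := Matrix.of fun i j => if S i j = 0 then 0 else X i j
  map_add' X Y := by
    ext i j
    by_cases h : S i j = 0 <;> simp [h]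
  map_smul' c X := by
    ext i j
    by_cases h : S i j = 0 <;> simp [h]

theorem supportProj_apply (S X : Matrix (Fin n) (Fin n) ℝ) (i j : Fin n) :
    supportProj S X i j = if S i j = 0 then 0 else X i j := rfl

theorem abs_mul_apply_le_of_left {P : Matrix (Fin n) (Fin n) ℝ} {β : ℝ} (hPt : Pᵀ = P)
    (hP : ∀ k, ‖Matrix.toEuclideanLin P (EuclideanSpace.single k 1)‖ ≤ β)
    (M : Matrix (Fin n) (Fin n) ℝ) (i j : Fin n) : |(P * M) i j| ≤ β * ‖M‖ := by
  have h := abs_transpose_mul_apply_le P M i j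
  rw [hPt] at h
  exact h.trans (mul_le_mul (hP i) (norm_toEuclideanLin_single_le M j) (norm_nonneg _)
    ((norm_nonneg _).trans (hP i)))

theorem abs_mul_apply_le_of_right {P : Matrix (Fin n) (Fin n) ℝ} {β : ℝ} (hPt : Pᵀ = P)
    (hP : ∀ k, ‖Matrix.toEuclideanLin P (EuclideanSpace.single k 1)‖ ≤ β)
    (M : Matrix (Fin n) (Fin n) ℝ) (i j : Fin n) : |(M * P) i j| ≤ β * ‖M‖ := by
  have h := abs_mul_apply_le_of_left hPt hP Mᵀ j i
  have h1 : P * Mᵀ = (M * P)ᵀ := by rw [Matrix.transpose_mul, hPt]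
  rwa [l2OpNorm_transpose, h1] at h

/-- Each of the two terms has a factor `P` on an outer side, and each such factor costs one `β`. -/
theorem abs_tangentProj_apply_le {P : Matrix (Fin n) (Fin n) ℝ} {β : ℝ} (hPt : Pᵀ = P)
    (hPP : P * P = P) (hP : ∀ k, ‖Matrix.toEuclideanLin P (EuclideanSpace.single k 1)‖ ≤ β)
    (M : Matrix (Fin n) (Fin n) ℝ) (i j : Fin n) : |tangentProj P M i j| ≤ 2 * β * ‖M‖ := by
  rw [tangentProj_apply, Matrix.add_apply, ← mul_assoc]
  have hβ : 0 ≤ β := (norm_nonneg _).trans (hP i)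
  have h1 : ‖(1 - P) * M‖ ≤ ‖M‖ :=
    (Matrix.l2_opNorm_mul _ _).trans (mul_le_of_le_one_left (norm_nonneg _)
      (l2OpNorm_le_one_of_projection (transpose_one_sub_of_projection hPt)
        (one_sub_mul_one_sub_of_projection hPP)))
  calc |(P * M) i j + ((1 - P) * M * P) i j|
      ≤ |(P * M) i j| + |((1 - P) * M * P) i j| := abs_add_le _ _
    _ ≤ β * ‖M‖ + β * ‖(1 - P) * M‖ :=
        add_le_add (abs_mul_apply_le_of_left hPt hP M i j) (abs_mul_apply_le_of_right hPt hP _ i j)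
    _ ≤ β * ‖M‖ + β * ‖M‖ := by gcongr
    _ = 2 * β * ‖M‖ := by ring

end Projection

/-! ### Dual certificate and exact recovery -/

section Certificate

open scoped Matrix.Norms.L2Operator

variable {n : ℕ}

/-- Transversality of the support space of `S` and the tangent space given by `P`. -/
theorem eq_zero_of_eq_supportProj_tangentProj {S P X : Matrix (Fin n) (Fin n) ℝ} {β : ℝ}
    (hβ0 : 0 ≤ β) (hPt : Pᵀ = P) (hPP : P * P = P)
    (hP : ∀ k, ‖Matrix.toEuclideanLin P (EuclideanSpace.single k 1)‖ ≤ β)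
    (hβ : (degMax S : ℝ) * β < 1 / 12) (hX : X = supportProj S (tangentProj P X)) : X = 0 := by
  have hXS : ∀ i j, S i j = 0 → X i j = 0 := fun i j h => by
    rw [hX, supportProj_apply, if_pos h]
  have hb : ∀ i j, |X i j| ≤ 2 * β * ‖X‖ := fun i j => by
    by_cases h : S i j = 0
    · rw [hXS i j h, abs_zero]
      positivity
    · have h1 : X i j = tangentProj P X i j := by
        conv_lhs => rw [hX]
        rw [supportProj_apply, if_neg h]
      rw [h1]
      exact abs_tangentProj_apply_le hPt hPP hP X i j
  -- With `d = degMax S` this says `‖X‖ ≤ 2 d β ‖X‖`, and `2 d β < 1/6`.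
  have h1 := l2OpNorm_le_degMax_mul (by positivity) hXS hb
  rw [← norm_le_zero_iff]
  nlinarith [norm_nonneg X]

/-- With `Ω` and `T` the support and tangent projections, the condition on the support reads `X - Ω
T X = Ω (γ sign S - P Q₀ P)` for `X` supported there. Transversality makes the left side injective,
hence surjective in finite dimension. -/
theorem exists_dualCertificate {S P Q₀ : Matrix (Fin n) (Fin n) ℝ} {β γ : ℝ}
    (hβ0 : 0 ≤ β) (hPt : Pᵀ = P) (hPP : P * P = P)
    (hP : ∀ k, ‖Matrix.toEuclideanLin P (EuclideanSpace.single k 1)‖ ≤ β)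
    (hβ : (degMax S : ℝ) * β < 1 / 12) (hβγ : 3 * β < γ) (hγ : (degMax S : ℝ) * γ < 2 / 3)
    (hQ₀ : ‖Q₀‖ ≤ 1) :
    ∃ X : Matrix (Fin n) (Fin n) ℝ, ‖X‖ < 1 ∧
      (∀ i j, S i j ≠ 0 →
        (P * Q₀ * P + (1 - P) * X * (1 - P)) i j = γ * SignType.sign (S i j)) ∧
      ∀ i j, S i j = 0 → |(P * Q₀ * P + (1 - P) * X * (1 - P)) i j| < γ := by
  set K : Matrix (Fin n) (Fin n) ℝ →ₗ[ℝ] Matrix (Fin n) (Fin n) ℝ :=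
    LinearMap.id - supportProj S ∘ₗ tangentProj P
  have hK : ∀ X, K X = X - supportProj S (tangentProj P X) := fun _ => rfl
  have hinj : Function.Injective K := by
    rw [← LinearMap.ker_eq_bot, LinearMap.ker_eq_bot']
    intro X hX
    exact eq_zero_of_eq_supportProj_tangentProj hβ0 hPt hPP hP hβ (sub_eq_zero.mp hX)
  set G : Matrix (Fin n) (Fin n) ℝ := Matrix.of fun i j => γ * SignType.sign (S i j)
  have hG : ∀ i j, G i j = γ * SignType.sign (S i j) := fun _ _ => rfl
  obtain ⟨X, hX⟩ := (LinearMap.injective_iff_surjective.mp hinj) (supportProj S (G - P * Q₀ * P))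
  have hX' : X = supportProj S (G - P * Q₀ * P + tangentProj P X) := by
    rw [map_add, ← hX, hK, sub_add_cancel]
  have hγ0 : 0 < γ := by linarith
  have hXoff : ∀ i j, S i j = 0 → X i j = 0 := fun i j h => by
    rw [hX', supportProj_apply, if_pos h]
  have hXon : ∀ i j, S i j ≠ 0 →
      X i j = γ * SignType.sign (S i j) - (P * Q₀ * P) i j + tangentProj P X i j :=
    fun i j h => by
      conv_lhs => rw [hX']
      rw [supportProj_apply, if_neg h]
      rfl
  have hQb : ∀ i j, |(P * Q₀ * P) i j| ≤ β := fun i j => by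
    rw [mul_assoc]
    refine (abs_mul_apply_le_of_left hPt hP _ i j).trans (mul_le_of_le_one_right hβ0 ?_)
    exact (Matrix.l2_opNorm_mul _ _).trans
      (mul_le_one₀ hQ₀ (norm_nonneg _) (l2OpNorm_le_one_of_projection hPt hPP))
  have hTb : ∀ i j, |tangentProj P X i j| ≤ 2 * β * ‖X‖ :=
    abs_tangentProj_apply_le hPt hPP hP X
  have hXb : ∀ i j, |X i j| ≤ γ + β + 2 * β * ‖X‖ := fun i j => by
    by_cases h : S i j = 0
    · rw [hXoff i j h, abs_zero]
      positivity
    · rw [hXon i j h]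
      have h1 : |γ * (SignType.sign (S i j) : ℝ)| ≤ γ := by
        rw [abs_mul, abs_of_pos hγ0]
        refine mul_le_of_le_one_right hγ0.le ?_
        rcases lt_trichotomy (S i j) 0 with h | h | h <;> simp [h]
      have h2 := hQb i j
      have h3 := hTb i j
      rw [abs_le] at *
      constructor <;> linarith
  have hXn := l2OpNorm_le_degMax_mul (by positivity) hXoff hXb
  -- With `d = degMax S`, `‖X‖ ≤ d γ + d β + 2 d β ‖X‖ ≤ 2/3 + 1/12 + ‖X‖/6`, so `‖X‖ ≤ 9/10`.
  have hX1 : ‖X‖ < 1 := by nlinarith [norm_nonneg X]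
  have hQ : ∀ i j, (P * Q₀ * P + (1 - P) * X * (1 - P)) i j =
      (P * Q₀ * P) i j + (X i j - tangentProj P X i j) := fun i j => by
    rw [← sub_tangentProj]
    rfl
  refine ⟨X, hX1, fun i j h => ?_, fun i j h => ?_⟩
  · rw [hQ, hXon i j h]
    ring
  · rw [hQ, hXoff i j h, zero_sub]
    have h2 := hQb i j
    have h3 := hTb i j
    -- Off the support the entry is at most `β + 2 β = 3 β < γ`.
    have h4 : 2 * β * ‖X‖ ≤ 2 * β := mul_le_of_le_one_right (by positivity) hX1.le
    rw [abs_le] at h2 h3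
    rw [abs_lt]
    constructor <;> linarith

theorem eq_zero_of_sum_sum_eq_zero {f : Fin n → Fin n → ℝ} (hf : ∀ i j, 0 ≤ f i j)
    (h : ∑ i, ∑ j, f i j = 0) (i j : Fin n) : f i j = 0 := by
  rw [Finset.sum_eq_zero_iff_of_nonneg fun i _ => Finset.sum_nonneg fun j _ => hf i j] at h
  have h1 := h i (Finset.mem_univ i)
  rw [Finset.sum_eq_zero_iff_of_nonneg fun j _ => hf i j] at h1
  exact h1 j (Finset.mem_univ j)

/-- Exact recovery: `(S₀, L₀)` is the strict minimizer of `γ ‖S‖₁ + ‖L‖_*` among all decompositions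
of `S₀ + L₀`. -/
theorem l1Norm_add_nuclearNorm_lt {S₀ L₀ S L : Matrix (Fin n) (Fin n) ℝ} {γ : ℝ}
    (hL₀ : L₀ᵀ = -L₀) (hd : (degMax S₀ : ℝ) * inc L₀ < 1 / 12) (hβγ : 3 * inc L₀ < γ)
    (hγ : (degMax S₀ : ℝ) * γ < 2 / 3) (hC : S + L = S₀ + L₀) (hne : L ≠ L₀) :
    γ * l1Norm S₀ + nuclearNorm L₀ < γ * l1Norm S + nuclearNorm L := by
  have hβ0 := inc_nonneg L₀
  obtain ⟨P, hPt, hPP, hPL, hLP, hP⟩ := exists_projection_colSpace hL₀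
  obtain ⟨Q₀, hQ₀, hQL⟩ := exists_trace_transpose_mul_eq_nuclearNorm L₀
  obtain ⟨X, hX1, hXon, hXoff⟩ := exists_dualCertificate hβ0 hPt hPP hP hd hβγ hγ hQ₀
  set Q := P * Q₀ * P + (1 - P) * X * (1 - P)
  have hPt' := transpose_one_sub_of_projection hPt
  have hPP' := one_sub_mul_one_sub_of_projection hPP
  set N := L - L₀
  have hN : N ≠ 0 := sub_ne_zero.mpr hne
  have hS : S = S₀ - N := by
    rw [eq_sub_iff_add_eq, add_sub, hC, add_sub_cancel_right]
  set Z := (1 - P) * N * (1 - P)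
  -- The slack `‖X‖ < 1` allows a small tilt of the certificate towards `N`, which gains `δ ‖Z‖_F²`
  -- in the subgradient inequality.
  obtain ⟨δ, hδ0, hδ⟩ : ∃ δ : ℝ, 0 < δ ∧ ‖X + δ • N‖ ≤ 1 := by
    have hpos : 0 < ‖N‖ := norm_pos_iff.mpr hN
    refine ⟨(1 - ‖X‖) / ‖N‖, div_pos (sub_pos.mpr hX1) hpos, (norm_add_le _ _).trans ?_⟩
    rw [norm_smul, Real.norm_of_nonneg (div_pos (sub_pos.mpr hX1) hpos).le,
      div_mul_cancel₀ _ hpos.ne']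
    linarith
  have hQ' : Q + δ • Z = P * Q₀ * P + (1 - P) * (X + δ • N) * (1 - P) := by
    simp only [Q, Z, mul_add, add_mul, Matrix.mul_smul, Matrix.smul_mul, add_assoc]
  have hQn : ‖Q + δ • Z‖ ≤ 1 := hQ' ▸ l2OpNorm_block_le_one hPt hPP hQ₀ hδ
  have hQL₀ : ((Q + δ • Z)ᵀ * L₀).trace = nuclearNorm L₀ := by
    have h0 : (1 - P) * L₀ = 0 := by rw [sub_mul, hPL, one_mul, sub_self]
    rw [hQ', Matrix.transpose_add, add_mul]
    simp only [Matrix.transpose_mul, hPt, hPt']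
    have h1 : (1 - P) * ((X + δ • N)ᵀ * (1 - P)) * L₀ = 0 := by
      rw [mul_assoc, mul_assoc, h0, mul_zero, mul_zero]
    rw [h1, add_zero, mul_assoc, mul_assoc, hPL, Matrix.trace_mul_comm, mul_assoc, hLP, hQL]
  have hZ : (Zᵀ * N).trace = (Zᵀ * Z).trace := by
    have h1 : Zᵀ * Z = Zᵀ * N * (1 - P) := by
      simp only [Z, Matrix.transpose_mul, hPt', ← mul_assoc]
      rw [mul_assoc _ (1 - P) (1 - P), hPP']
    have h2 : (1 - P) * Zᵀ = Zᵀ := by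
      simp only [Z, Matrix.transpose_mul, hPt', ← mul_assoc, hPP']
    rw [h1, Matrix.trace_mul_comm (Zᵀ * N), ← mul_assoc, h2]
  have hsub : nuclearNorm L₀ + (Qᵀ * N).trace + δ * (Zᵀ * Z).trace ≤ nuclearNorm L := by
    have h1 := trace_transpose_mul_le_nuclearNorm hQn L
    have h2 : L = L₀ + N := (add_sub_cancel _ _).symm
    rw [← hZ]
    calc _ = ((Q + δ • Z)ᵀ * L).trace := by
          rw [h2, mul_add, Matrix.trace_add, hQL₀, Matrix.transpose_add Q, add_mul,
            Matrix.trace_add, Matrix.transpose_smul, Matrix.smul_mul, Matrix.trace_smul,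
            smul_eq_mul, add_assoc]
      _ ≤ _ := h1
  -- Entrywise excess in the subgradient inequality for `γ ‖·‖₁`. If `(S, L)` did no worse, both `∑
  -- f` and `‖Z‖_F²` would vanish: `Z = 0` puts `N` in the tangent space, `f = 0` puts it on the
  -- support, and transversality gives `N = 0`.
  set f : Fin n → Fin n → ℝ := fun i j => γ * |S i j| - γ * |S₀ i j| + Q i j * N i j
  have hγ0 : 0 < γ := by linarith
  have hf_off : ∀ i j, S₀ i j = 0 → (γ - |Q i j|) * |N i j| ≤ f i j := fun i j h => by
    have h1 := neg_abs_le (Q i j * N i j)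
    rw [abs_mul] at h1
    simp only [f, hS, Matrix.sub_apply, h, zero_sub, abs_neg, abs_zero]
    linarith
  have hf : ∀ i j, 0 ≤ f i j := fun i j => by
    by_cases h : S₀ i j = 0
    · exact (mul_nonneg (sub_nonneg.mpr (hXoff i j h).le) (abs_nonneg _)).trans (hf_off i j h)
    · simp only [f, hS, Matrix.sub_apply]
      rw [hXon i j h]
      rcases lt_or_gt_of_ne h with h | h
      · have := neg_abs_le (S₀ i j - N i j)
        rw [abs_of_neg h, sign_neg h]
        simp only [SignType.coe_neg_one]
        nlinarith
      · have := le_abs_self (S₀ i j - N i j)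
        rw [abs_of_pos h, sign_pos h]
        simp only [SignType.coe_one]
        nlinarith
  have hsum : ∑ i, ∑ j, f i j = γ * l1Norm S - γ * l1Norm S₀ + (Qᵀ * N).trace := by
    rw [trace_transpose_mul_eq_sum, l1Norm, l1Norm]
    simp only [f, Finset.mul_sum, Finset.sum_add_distrib, Finset.sum_sub_distrib]
  by_contra! hle
  have hZsq : (Zᵀ * Z).trace = ∑ i, ∑ j, Z i j ^ 2 := by
    rw [trace_transpose_mul_eq_sum]
    simp only [sq]
  have hZ0 : 0 ≤ ∑ i, ∑ j, Z i j ^ 2 :=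
    Finset.sum_nonneg fun _ _ => Finset.sum_nonneg fun _ _ => sq_nonneg _
  have hf0 : 0 ≤ ∑ i, ∑ j, f i j := Finset.sum_nonneg fun i _ => Finset.sum_nonneg fun j _ => hf i j
  have hδZ := mul_nonneg hδ0.le hZ0
  have hZz : ∑ i, ∑ j, Z i j ^ 2 = 0 := by
    have h1 : δ * ∑ i, ∑ j, Z i j ^ 2 = 0 := by rw [hZsq] at hsub; linarith
    exact (mul_eq_zero.mp h1).resolve_left hδ0.ne'
  have hfz : ∑ i, ∑ j, f i j = 0 := by rw [hZsq] at hsub; linarith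
  have hZzero : Z = 0 := by
    ext i j
    exact pow_eq_zero_iff two_ne_zero |>.mp
      (eq_zero_of_sum_sum_eq_zero (fun i j => sq_nonneg (Z i j)) hZz i j)
  have hNT : N = tangentProj P N := sub_eq_zero.mp ((sub_tangentProj P N).trans hZzero)
  refine hN (eq_zero_of_eq_supportProj_tangentProj hβ0 hPt hPP hP hd ?_)
  rw [← hNT]
  ext i j
  rw [supportProj_apply]
  split_ifs with h
  · have h2 := hf_off i j h
    rw [eq_zero_of_sum_sum_eq_zero hf hfz i j] at h2
    have h3 := sub_pos.mpr (hXoff i j h)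
    exact abs_nonpos_iff.mp (nonpos_of_mul_nonpos_right h2 h3)
  · rfl

end Certificate

/-! ### Unique solutions on the three intervals; existence -/

section Solutions

variable {n : ℕ}

theorem solutionSet_eq_singleton {C : Matrix (Fin n) (Fin n) ℝ} {t : ℝ}
    {p : Matrix (Fin n) (Fin n) ℝ × Matrix (Fin n) (Fin n) ℝ} (hp : p ∈ feasible C)
    (h : ∀ q ∈ feasible C, q ≠ p → objective t p < objective t q) : solutionSet C t = {p} := by
  ext q
  rw [Set.mem_singleton_iff]
  constructor
  · intro hq
    by_contra hne
    exact (h q hq.1 hne).not_ge (hq.2 hp)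
  · rintro rfl
    refine ⟨hp, fun r hr => ?_⟩
    by_cases hrq : r = q
    · rw [hrq]
      exact le_refl (objective t q)
    · exact (h r hr hrq).le

theorem solutionSet_eq_left {C : Matrix (Fin n) (Fin n) ℝ} (hC : Cᵀ = -C) {t : ℝ} (ht : 0 ≤ t)
    (htn : t * n < 1 - t) : solutionSet C t = {(C, 0)} := by
  refine solutionSet_eq_singleton ⟨add_zero C, hC, by simp⟩ ?_
  rintro ⟨S, L⟩ ⟨hSL, -, -⟩ hne
  have hL : L ≠ 0 := by
    rintro rfl
    exact hne (by rw [← hSL]; simp)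
  have h1 : l1Norm C ≤ l1Norm S + l1Norm L := hSL ▸ l1Norm_add_le S L
  have h2 := l1Norm_le_nuclearNorm L
  have h3 : 0 < l1Norm L := not_le.mp fun h => hL (eq_zero_of_l1Norm_le_zero h)
  have h4 : 0 < nuclearNorm L := by
    refine (nuclearNorm_nonneg L).lt_of_ne' fun h => ?_
    rw [h, mul_zero] at h2
    exact h3.not_ge h2
  simp only [objective, nuclearNorm_zero, mul_zero, add_zero]
  calc t * l1Norm C ≤ t * (l1Norm S + n * nuclearNorm L) := by gcongr; linarith
    _ = t * l1Norm S + t * n * nuclearNorm L := by ring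
    _ < t * l1Norm S + (1 - t) * nuclearNorm L := by gcongr

theorem solutionSet_eq_right {C : Matrix (Fin n) (Fin n) ℝ} (hC : Cᵀ = -C) {t : ℝ} (ht : t ≤ 1)
    (htt : 1 - t < t) : solutionSet C t = {(0, C)} := by
  refine solutionSet_eq_singleton ⟨zero_add C, by simp, hC⟩ ?_
  rintro ⟨S, L⟩ ⟨hSL, -, -⟩ hne
  have hS : S ≠ 0 := by
    rintro rfl
    exact hne (by rw [← hSL]; simp)
  have h1 : nuclearNorm C ≤ nuclearNorm S + nuclearNorm L := hSL ▸ nuclearNorm_add_le S L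
  have h2 := nuclearNorm_le_l1Norm S
  have h3 : 0 < l1Norm S := not_le.mp fun h => hS (eq_zero_of_l1Norm_le_zero h)
  simp only [objective, l1Norm_zero, mul_zero, zero_add]
  calc (1 - t) * nuclearNorm C ≤ (1 - t) * (l1Norm S + nuclearNorm L) := by
        have : 0 ≤ 1 - t := sub_nonneg.mpr ht
        gcongr
        linarith
    _ = (1 - t) * l1Norm S + (1 - t) * nuclearNorm L := by ring
    _ < t * l1Norm S + (1 - t) * nuclearNorm L := by gcongr

/-- Dividing the objective by `1 - t` turns it into exact recovery with `γ = t / (1 - t)`. -/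
theorem solutionSet_eq_exact {S₀ L₀ : Matrix (Fin n) (Fin n) ℝ} (hS : S₀ᵀ = -S₀)
    (hL : L₀ᵀ = -L₀) (hd : (degMax S₀ : ℝ) * inc L₀ < 1 / 12) {t : ℝ} (ht : t < 1)
    (hinc : 3 * inc L₀ * (1 - t) < t) (hdeg : degMax S₀ * t < 2 / 3 * (1 - t)) :
    solutionSet (S₀ + L₀) t = {(S₀, L₀)} := by
  have ht' : 0 < 1 - t := sub_pos.mpr ht
  refine solutionSet_eq_singleton ⟨rfl, hS, hL⟩ ?_
  rintro ⟨S, L⟩ ⟨hSL, -, -⟩ hne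
  have hLne : L ≠ L₀ := by
    rintro rfl
    exact hne (congrArg (·, L) (add_right_cancel hSL))
  have h1 : 3 * inc L₀ < t / (1 - t) := by rwa [lt_div_iff₀ ht']
  have h2 : degMax S₀ * (t / (1 - t)) < 2 / 3 := by rwa [← mul_div_assoc, div_lt_iff₀ ht']
  have h3 := mul_lt_mul_of_pos_left (l1Norm_add_nuclearNorm_lt hL hd h1 h2 hSL hLne) ht'
  simp only [mul_add, ← mul_assoc, mul_div_cancel₀ t ht'.ne'] at h3
  exact h3

/-- For `t > 0` the `ℓ₁` term is coercive, so minimizing over `S` reduces to a compact box.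
Coercivity in `S` can no longer be read off this term at `t = 0`, where the explicit solution `(C,
0)` serves instead. -/
theorem nonempty_solutionSet {C : Matrix (Fin n) (Fin n) ℝ} (hC : Cᵀ = -C) {t : ℝ}
    (ht0 : 0 < t) (ht1 : t ≤ 1) : (solutionSet C t).Nonempty := by
  set g : Matrix (Fin n) (Fin n) ℝ → ℝ := fun S => objective t (S, C - S)
  have hg : Continuous g := by
    have h1 : Continuous fun S : Matrix (Fin n) (Fin n) ℝ => nuclearNorm (C - S) :=
      continuous_nuclearNorm.comp (continuous_const.sub continuous_id)
    exact (continuous_const.mul continuous_l1Norm).add (continuous_const.mul h1)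
  set R := g 0 / t
  set B : Set (Matrix (Fin n) (Fin n) ℝ) := Set.univ.pi fun _ => Set.univ.pi fun _ => Set.Icc (-R) R
  have hB : IsCompact B := isCompact_univ_pi fun _ => isCompact_univ_pi fun _ => isCompact_Icc
  have hgl : ∀ S, t * l1Norm S ≤ g S := fun S =>
    le_add_of_nonneg_right (mul_nonneg (sub_nonneg.mpr ht1) (nuclearNorm_nonneg _))
  have hmemB : ∀ S, g S ≤ g 0 → S ∈ B := fun S h i _ j _ => by
    refine abs_le.mp ((abs_apply_le_l1Norm S i j).trans ?_)
    rw [le_div_iff₀ ht0, mul_comm]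
    exact (hgl S).trans h
  have hK : IsCompact (B ∩ {S | Sᵀ = -S}) :=
    hB.inter_right (isClosed_eq continuous_id.matrix_transpose continuous_neg)
  obtain ⟨S, ⟨-, hS⟩, hmin⟩ := hK.exists_isMinOn ⟨0, hmemB 0 le_rfl, by simp⟩ hg.continuousOn
  have hS' : Sᵀ = -S := hS
  have hmin' : ∀ S', S'ᵀ = -S' → g S ≤ g S' := fun S' hS' => by
    rcases le_total (g S') (g 0) with h | h
    · exact hmin ⟨hmemB S' h, hS'⟩
    · exact le_trans (hmin ⟨hmemB 0 le_rfl, by simp⟩) h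
  refine ⟨(S, C - S), ⟨add_sub_cancel _ _, hS', ?_⟩, ?_⟩
  · rw [Matrix.transpose_sub, hC, hS', neg_sub_neg, neg_sub]
  · rintro ⟨S', L'⟩ ⟨hSL, hSt, -⟩
    have h := hmin' S' hSt
    have hL' : C - S' = L' := sub_eq_iff_eq_add'.mpr hSL.symm
    simp only [g, hL'] at h
    exact h

end Solutions

/-! ### Stepping along the solution path -/

section Path

variable {n : ℕ}

theorem frobNorm_nonneg (M : Matrix (Fin n) (Fin n) ℝ) : 0 ≤ frobNorm M := Real.sqrt_nonneg _

theorem eq_zero_of_frobNorm_eq_zero {M : Matrix (Fin n) (Fin n) ℝ} (h : frobNorm M = 0) :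
    M = 0 := by
  have h0 : ∑ i, ∑ j, M i j ^ 2 = 0 := (Real.sqrt_eq_zero (Finset.sum_nonneg fun _ _ =>
    Finset.sum_nonneg fun _ _ => sq_nonneg _)).mp h
  ext i j
  exact pow_eq_zero_iff two_ne_zero |>.mp
    (eq_zero_of_sum_sum_eq_zero (fun i j => sq_nonneg (M i j)) h0 i j)

theorem diffT_eq_zero_iff {S L : ℝ → Matrix (Fin n) (Fin n) ℝ} {ε t : ℝ} :
    diffT S L ε t = 0 ↔ S (t - ε) = S t ∧ L (t - ε) = L t := by
  constructor
  · intro h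
    have h1 := frobNorm_nonneg (S (t - ε) - S t)
    have h2 := frobNorm_nonneg (L (t - ε) - L t)
    unfold diffT at h
    exact ⟨sub_eq_zero.mp (eq_zero_of_frobNorm_eq_zero (by linarith)),
      sub_eq_zero.mp (eq_zero_of_frobNorm_eq_zero (by linarith))⟩
  · rintro ⟨h1, h2⟩
    simp [diffT, h1, h2, frobNorm]

/-- If `diffT` vanishes on `(a, u]`, then stepping down from `u` does not change the path. -/
theorem exists_eq_of_diffT_eq_zero {S L : ℝ → Matrix (Fin n) (Fin n) ℝ} {ε a u : ℝ} (hε : 0 < ε)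
    (hu : a < u) (h : ∀ t ∈ Set.Ioc a u, diffT S L ε t = 0) :
    ∃ s ∈ Set.Ioc (a - ε) a, S s = S u ∧ L s = L u := by
  have key : ∀ k : ℕ, a - ε < u - k * ε → S (u - k * ε) = S u ∧ L (u - k * ε) = L u := by
    intro k
    induction k with
    | zero => simp
    | succ k ih =>
      intro hk
      push_cast at hk ⊢
      have hkε : 0 ≤ k * ε := by positivity
      obtain ⟨h1, h2⟩ := ih (by linarith)
      obtain ⟨h3, h4⟩ := diffT_eq_zero_iff.mp (h (u - k * ε) ⟨by linarith, by linarith⟩)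
      have h5 : u - (k + 1) * ε = u - k * ε - ε := by ring
      rw [h5]
      exact ⟨h3.trans h1, h4.trans h2⟩
  -- The ceiling is the first number of steps that reaches `a` or below, hence overshoots by less
  -- than `ε`.
  have hk1 : u - ⌈(u - a) / ε⌉₊ * ε ≤ a := by
    have := Nat.le_ceil ((u - a) / ε)
    rw [div_le_iff₀ hε] at this
    linarith
  have hk2 : a - ε < u - ⌈(u - a) / ε⌉₊ * ε := by
    have := Nat.ceil_lt_add_one (div_nonneg (sub_nonneg.mpr hu.le) hε.le)
    rw [← sub_lt_iff_lt_add, lt_div_iff₀ hε] at this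
    linarith
  exact ⟨_, ⟨hk2, hk1⟩, key _ hk2⟩

theorem IsSolutionPath.eq_of_solutionSet_eq {C S' L' : Matrix (Fin n) (Fin n) ℝ}
    {S L : ℝ → Matrix (Fin n) (Fin n) ℝ} (hSL : IsSolutionPath C S L) {t : ℝ}
    (ht : t ∈ Set.Icc (0 : ℝ) 1) (h : solutionSet C t = {(S', L')}) : S t = S' ∧ L t = L' := by
  have h1 := hSL t ht
  rw [h, Set.mem_singleton_iff, Prod.mk.injEq] at h1
  exact h1

theorem IsSolutionPath.diffT_eq_zero {C S' L' : Matrix (Fin n) (Fin n) ℝ}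
    {S L : ℝ → Matrix (Fin n) (Fin n) ℝ} (hSL : IsSolutionPath C S L) {u v ε : ℝ} (hu : 0 ≤ u)
    (hv : v ≤ 1) (hε : 0 ≤ ε) (h : ∀ t ∈ Set.Icc u v, solutionSet C t = {(S', L')})
    {t : ℝ} (ht : t ∈ Set.Icc (u + ε) v) : diffT S L ε t = 0 := by
  obtain ⟨ht1, ht2⟩ := ht
  obtain ⟨h1, h2⟩ := hSL.eq_of_solutionSet_eq (t := t) ⟨by linarith, by linarith⟩
    (h t ⟨by linarith, ht2⟩)
  obtain ⟨h3, h4⟩ := hSL.eq_of_solutionSet_eq (t := t - ε) ⟨by linarith, by linarith⟩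
    (h (t - ε) ⟨by linarith, by linarith⟩)
  exact diffT_eq_zero_iff.mpr ⟨h3.trans h1.symm, h4.trans h2.symm⟩

/-- In terms of `γ = t / (1 - t)` the interval is `[3 β + δ/2, 3 β + δ]`. There `d γ ≤ 3 d β + d δ <
1/4 + 1/4 < 2/3`. -/
theorem exists_exact_recovery_interval {d β : ℝ} (hd : 0 ≤ d) (hβ : 0 ≤ β) (h : d * β < 1 / 12) :
    ∃ t₁ t₂ : ℝ, 0 < t₁ ∧ t₁ < t₂ ∧ t₂ < 1 ∧
      ∀ t ∈ Set.Icc t₁ t₂, 3 * β * (1 - t) < t ∧ d * t < 2 / 3 * (1 - t) := by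
  obtain ⟨δ, hδ0, hδ⟩ : ∃ δ : ℝ, 0 < δ ∧ d * δ < 1 / 4 := by
    refine ⟨1 / (4 * (d + 1)), by positivity, ?_⟩
    rw [mul_one_div, div_lt_iff₀ (by positivity)]
    linarith
  have hγ₁ : 0 < 1 + (3 * β + δ / 2) := by positivity
  have hγ₂ : 0 < 1 + (3 * β + δ) := by positivity
  refine ⟨(3 * β + δ / 2) / (1 + (3 * β + δ / 2)), (3 * β + δ) / (1 + (3 * β + δ)), by positivity,
    ?_, ?_, ?_⟩
  · rw [div_lt_div_iff₀ hγ₁ hγ₂]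
    linarith
  · rw [div_lt_one hγ₂]
    linarith
  · rintro t ⟨h1, h2⟩
    rw [div_le_iff₀ hγ₁] at h1
    rw [le_div_iff₀ hγ₂] at h2
    have ht : t < 1 := by nlinarith
    constructor
    · nlinarith
    · nlinarith

end Path

theorem proposition3 {n : ℕ} (C S₀ L₀ : Matrix (Fin n) (Fin n) ℝ)
    (hS : S₀ᵀ = -S₀) (hL : L₀ᵀ = -L₀) (hC : C = S₀ + L₀)
    (h : (degMax S₀ : ℝ) * inc L₀ < 1 / 12) :
    (∀ t ∈ Set.Icc (0 : ℝ) 1, (solutionSet C t).Nonempty) ∧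
    ∃ a t₁ t₂ b : ℝ, 0 < a ∧ a < t₁ ∧ t₁ < t₂ ∧ t₂ < b ∧ b < 1 ∧
      (∀ t ∈ Set.Icc 0 a, solutionSet C t = {(C, 0)}) ∧
      (∀ t ∈ Set.Icc t₁ t₂, solutionSet C t = {(S₀, L₀)}) ∧
      (∀ t ∈ Set.Icc b 1, solutionSet C t = {(0, C)}) ∧
      ∃ ε₀ : ℝ, 0 < ε₀ ∧ ε₀ < a ∧ t₁ + ε₀ < t₂ ∧ b + ε₀ < 1 ∧
        ∀ ε ∈ Set.Ioc 0 ε₀, ∀ S L : ℝ → Matrix (Fin n) (Fin n) ℝ, IsSolutionPath C S L →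
          (∀ t ∈ Set.Icc ε a, diffT S L ε t = 0) ∧
          (∀ t ∈ Set.Icc (t₁ + ε) t₂, diffT S L ε t = 0) ∧
          (∀ t ∈ Set.Icc (b + ε) 1, diffT S L ε t = 0) ∧
          (S₀ ≠ 0 → L₀ ≠ 0 →
            (∃ t ∈ Set.Ioo a (t₁ + ε), diffT S L ε t ≠ 0) ∧
            (∃ t ∈ Set.Ioo t₂ (b + ε), diffT S L ε t ≠ 0)) := by
  have hCt : Cᵀ = -C := by rw [hC, Matrix.transpose_add, hS, hL, neg_add]
  have hleft : ∀ t : ℝ, 0 ≤ t → t ≤ 1 / (n + 2) → solutionSet C t = {(C, 0)} := fun t ht0 ht => by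
    refine solutionSet_eq_left hCt ht0 ?_
    rw [le_div_iff₀ (by positivity)] at ht
    rcases ht0.eq_or_lt with rfl | hpos
    · simp
    · linarith
  refine ⟨fun t ht => ?_, ?_⟩
  · rcases ht.1.eq_or_lt with rfl | hpos
    · rw [hleft 0 le_rfl (by positivity)]
      exact Set.singleton_nonempty _
    · exact nonempty_solutionSet hCt hpos ht.2
  obtain ⟨t₁, t₂, ht₁, ht₁₂, ht₂, hint⟩ :=
    exists_exact_recovery_interval (Nat.cast_nonneg (degMax S₀)) (inc_nonneg L₀) h
  obtain ⟨a, ha0, hat, han⟩ : ∃ a : ℝ, 0 < a ∧ a < t₁ ∧ a ≤ 1 / (n + 2) :=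
    ⟨min (t₁ / 2) (1 / (n + 2)), by positivity, (min_le_left _ _).trans_lt (half_lt_self ht₁),
      min_le_right _ _⟩
  obtain ⟨b, hb2, hbt, hb1⟩ : ∃ b : ℝ, 1 / 2 < b ∧ t₂ < b ∧ b < 1 := by
    obtain ⟨b, hb, hb1⟩ := exists_between (max_lt (by norm_num : (1 / 2 : ℝ) < 1) ht₂)
    exact ⟨b, (le_max_left _ _).trans_lt hb, (le_max_right _ _).trans_lt hb, hb1⟩
  -- A step shorter than each plateau cannot jump over it.
  obtain ⟨ε₀, hε₀, hε₀'⟩ := exists_between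
    (lt_min ha0 (lt_min (sub_pos.mpr ht₁₂) (sub_pos.mpr hb1)))
  obtain ⟨hεa, hεt, hεb⟩ : ε₀ < a ∧ ε₀ < t₂ - t₁ ∧ ε₀ < 1 - b := by
    rwa [lt_min_iff, lt_min_iff] at hε₀'
  have hA : ∀ t ∈ Set.Icc 0 a, solutionSet C t = {(C, 0)} := fun t ht =>
    hleft t ht.1 (ht.2.trans han)
  have hT : ∀ t ∈ Set.Icc t₁ t₂, solutionSet C t = {(S₀, L₀)} := fun t ht =>
    hC ▸ solutionSet_eq_exact hS hL h (ht.2.trans_lt ht₂) (hint t ht).1 (hint t ht).2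
  have hB : ∀ t ∈ Set.Icc b 1, solutionSet C t = {(0, C)} := fun t ht =>
    solutionSet_eq_right hCt ht.2 (by linarith [ht.1])
  refine ⟨a, t₁, t₂, b, ha0, hat, ht₁₂, hbt, hb1, hA, hT, hB, ε₀, hε₀, hεa, by linarith,
    by linarith, ?_⟩
  rintro ε ⟨hε, hεε₀⟩ S L hSL
  refine ⟨fun t ht => hSL.diffT_eq_zero le_rfl (by linarith) hε.le hA (by rwa [zero_add]),
    fun t ht => hSL.diffT_eq_zero ht₁.le ht₂.le hε.le hT ht,
    fun t ht => hSL.diffT_eq_zero (by linarith) le_rfl hε.le hB ht, fun hS0 hL0 => ⟨?_, ?_⟩⟩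
  -- Stepping down from `t₁` would land in `(a - ε, a] ⊆ [0, a]` with the low-rank part unchanged,
  -- forcing `L₀ = 0`.
  · by_contra! hzero
    obtain ⟨s, ⟨hs1, hs2⟩, -, hLs⟩ := exists_eq_of_diffT_eq_zero hε hat
      fun t ht => hzero t ⟨ht.1, by linarith [ht.2]⟩
    obtain ⟨-, h1⟩ := hSL.eq_of_solutionSet_eq (t := s) ⟨by linarith, by linarith⟩
      (hA s ⟨by linarith, hs2⟩)
    obtain ⟨-, h2⟩ := hSL.eq_of_solutionSet_eq (t := t₁) ⟨ht₁.le, by linarith⟩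
      (hT t₁ ⟨le_rfl, ht₁₂.le⟩)
    exact hL0 (h2.symm.trans (hLs.symm.trans h1))
  -- Likewise from `b` into `(t₂ - ε, t₂] ⊆ [t₁, t₂]`, now comparing the sparse parts.
  · by_contra! hzero
    obtain ⟨s, ⟨hs1, hs2⟩, hSs, -⟩ := exists_eq_of_diffT_eq_zero hε hbt
      fun t ht => hzero t ⟨ht.1, by linarith [ht.2]⟩
    obtain ⟨h1, -⟩ := hSL.eq_of_solutionSet_eq (t := s) ⟨by linarith, by linarith⟩
      (hT s ⟨by linarith, hs2⟩)
    obtain ⟨h2, -⟩ := hSL.eq_of_solutionSet_eq (t := b) ⟨by linarith, hb1.le⟩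
      (hB b ⟨le_rfl, hb1.le⟩)
    exact hS0 (h1.symm.trans (hSs.trans h2))
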